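/- Let $E$ be a real or complex Banach space with a Schauder basis $(e_i)_{i\in\mathbb N}$. For $x\in E$ let $\mathrm{supp}(x)$ be the set of indices at which the basis expansion of $x$ has a non-zero coefficient; for $k\in\mathbb N$ write $k<x$ if $k<\min \mathrm{supp}(x)$, and write $x<y$ if $\max\mathrm{supp}(x)<\min\mathrm{supp}(y)$ (for non-zero finitely supported $x,y$). Let $bb(e_i)\subseteq E^{\mathbb N}$ be the set of infinite normalised block sequences, i.e. sequences $(x_i)$ of norm-one vectors in the (non-closed) linear span of $(e_i)$ with $x_0<x_1<x_2<\cdots$. In the infinite asymptotic game, players I and II alternate, I beginning: I plays natural numbers $n_0,n_1,n_2,\ldots$ and II plays norm-one vectors $x_0<x_1<x_2<\cdots$ in the linear span of $(e_i)$ with $n_i<x_i$ for all $i$. The outcome is the sequence $(x_i)_{i\in\mathbb N}$, and II has a strategy to play in a set $\mathcal B\subseteq bb(e_i)$ if II can always play, according to the rules and as a function of the previous moves of I, so that the outcome belongs to $\mathcal B$ whatever I plays. For $(x_i),(y_i)\in bb(e_i)$ write $(x_i)\sim(y_i)$ if the map $x_i\mapsto y_i$ extends to a linear isomorphism $T$ of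 $\overline{\mathrm{span}}(x_i)$ onto $\overline{\mathrm{span}}(y_i)$, and $(x_i)\sim_K(y_i)$ if moreover $\|T\|\cdot\|T^{-1}\|\le K$. Suppose that $\mathcal A\subseteq bb(e_i)$ is analytic (as a subset of the Polish space $E^{\mathbb N}$) and that II has a strategy to play in $$\mathcal A_\sim=\{(x_i)\in bb(e_i) : \exists (y_i)\in\mathcal A\;\ (x_i)\sim(y_i)\}.$$ Then there is a real number $K\ge 1$ such that II has a strategy to play in $$\mathcal A_K=\{(x_i)\in bb(e_i) : \exists (y_i)\in\mathcal A\;\ (x_i)\sim_K(y_i)\}.$$ -/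

import Mathlib

open MeasureTheory

namespace AsymptoticGame

variable {𝕜 X : Type*} [RCLike 𝕜] [NormedAddCommGroup X] [NormedSpace 𝕜 X]

/-- The support of a vector with respect to the basis `b = (e_i)`. It is finite for vectors in the
linear span of the basis. -/
def supp (b : SchauderBasis 𝕜 X) (x : X) : Set ℕ :=
  {i | b.coord i x ≠ 0}

/-- `k < x`: the number `k` lies strictly below the support of `x`. -/
def NatBelow (b : SchauderBasis 𝕜 X) (k : ℕ) (x : X) : Prop :=
  ∀ i ∈ supp b x, k < i

/-- `x < y`: the support of `x` lies strictly below the support of `y`. -/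
def VecBelow (b : SchauderBasis 𝕜 X) (x y : X) : Prop :=
  ∀ i ∈ supp b x, ∀ j ∈ supp b y, i < j

/-- `bb(e_i)`: the set of infinite normalised block sequences, i.e. the sequences of norm-one
vectors of the (non-closed) linear span of the basis with successive supports. -/
def bb (b : SchauderBasis 𝕜 X) : Set (ℕ → X) :=
  {x | (∀ i, x i ∈ Submodule.span 𝕜 (Set.range b)) ∧ (∀ i, ‖x i‖ = 1) ∧
    ∀ i, VecBelow b (x i) (x (i + 1))}

/-- `(n, x)` is a (complete) run of the infinite asymptotic game that respects the rules:
I plays natural numbers `n i`, II plays normalised vectors `x 0 < x 1 < ⋯` of the linear span of the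
basis, with `n i < x i`. -/
def IsRun (b : SchauderBasis 𝕜 X) (n : ℕ → ℕ) (x : ℕ → X) : Prop :=
  x ∈ bb b ∧ ∀ i, NatBelow b (n i) (x i)

/-- The sequence of vectors played by II when II follows `σ` and I plays `n 0, n 1, …`:
the `i`-th vector is the answer `σ [n 0, …, n i]`. -/
def outcome (σ : List ℕ → X) (n : ℕ → ℕ) (i : ℕ) : X :=
  σ ((List.range (i + 1)).map n)

/-- Player II has a strategy in the infinite asymptotic game to play in `A`. -/
def IIHasStrategy (b : SchauderBasis 𝕜 X) (A : Set (ℕ → X)) : Prop :=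
  ∃ σ : List ℕ → X, ∀ n : ℕ → ℕ, IsRun b n (outcome σ n) ∧ outcome σ n ∈ A

variable (𝕜) in
/-- The closed linear span `[x_i]`. -/
def closedSpan (x : ℕ → X) : Submodule 𝕜 X :=
  (Submodule.span 𝕜 (Set.range x)).topologicalClosure

variable (𝕜) in
theorem mem_closedSpan (x : ℕ → X) (i : ℕ) : x i ∈ closedSpan 𝕜 x :=
  Submodule.le_topologicalClosure _ (Submodule.subset_span ⟨i, rfl⟩)

variable (𝕜) in
/-- `(x_i) ∼ (y_i)`: the map `x_i ↦ y_i` extends to an isomorphism of the closed linear spans. -/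
def SeqEquiv (x y : ℕ → X) : Prop :=
  ∃ T : closedSpan 𝕜 x ≃L[𝕜] closedSpan 𝕜 y,
    ∀ i, T ⟨x i, mem_closedSpan 𝕜 x i⟩ = ⟨y i, mem_closedSpan 𝕜 y i⟩

variable (𝕜) in
/-- `(x_i) ∼_K (y_i)`: the map `x_i ↦ y_i` extends to an isomorphism `T` of the closed linear spans
with `‖T‖ * ‖T⁻¹‖ ≤ K`. -/
def SeqEquivConst (K : ℝ) (x y : ℕ → X) : Prop :=
  ∃ T : closedSpan 𝕜 x ≃L[𝕜] closedSpan 𝕜 y,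
    (∀ i, T ⟨x i, mem_closedSpan 𝕜 x i⟩ = ⟨y i, mem_closedSpan 𝕜 y i⟩) ∧
    ‖(T : closedSpan 𝕜 x →L[𝕜] closedSpan 𝕜 y)‖ *
      ‖(T.symm : closedSpan 𝕜 y →L[𝕜] closedSpan 𝕜 x)‖ ≤ K

/-- `A_∼`. -/
def saturation (b : SchauderBasis 𝕜 X) (A : Set (ℕ → X)) : Set (ℕ → X) :=
  {x | x ∈ bb b ∧ ∃ y ∈ A, SeqEquiv 𝕜 x y}

/-- `A_K`. -/
def saturationConst (b : SchauderBasis 𝕜 X) (K : ℝ) (A : Set (ℕ → X)) : Set (ℕ → X) :=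
  {x | x ∈ bb b ∧ ∃ y ∈ A, SeqEquivConst 𝕜 K x y}

end AsymptoticGame

/-!
Let `Ψ` send a play of I to the outcome of the given strategy. By continuity of `Ψ`, the sets `B K`
of plays `n` such that `Ψ n` is `K`-equivalent to a member of `A` are analytic, and they cover
`ℕ → ℕ`. A set of sequences is *strongly dominating* when no bound depending on the position
prevents a play exceeding it from entering the set. A countable union of sets that are strongly
dominating from no position is not strongly dominating, so some `B K` is strongly dominating from
some position, of length `m` say. Being a continuous image of `ℕ → ℕ`, it then contains all the
branches of a Laver tree with that position as its stem: the branch is extended above any prescribed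
bounds along with a preimage of it, whose next digit can be fixed as soon as a well-founded plan has
led to a position from which the plays with that digit are still strongly dominating.

Hence II can answer I's moves by letting a fictitious I play a large enough branch of this tree
against `Ψ`. The first `m` moves of the branch are the stem, so they may be too small; there II
plays basis vectors instead. Changing `m` vectors of a normalised block sequence costs only a factor
that depends on `m` and the basis constant.
-/

namespace AsymptoticGame

open Filter Topology PiNat

section Positions

variable {α : Type*}

/-- The sequences passing through the position `u`. As in `PiNat.res`, a position lists the moves
made so far in reverse order, so that `a :: u` is the position after the further move `a`. -/
def branchesThrough (u : List α) : Set (ℕ → α) :=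
  {f | res f u.length = u}

theorem mem_branchesThrough_res (f : ℕ → α) (n : ℕ) : f ∈ branchesThrough (res f n) := by
  simp [branchesThrough]

theorem branchesThrough_nil : branchesThrough ([] : List α) = Set.univ := by
  simp [branchesThrough]

theorem mem_branchesThrough_cons {f : ℕ → α} {a : α} {u : List α} :
    f ∈ branchesThrough (a :: u) ↔ f u.length = a ∧ f ∈ branchesThrough u := by
  simp [branchesThrough]

theorem branchesThrough_cons_subset (a : α) (u : List α) :
    branchesThrough (a :: u) ⊆ branchesThrough u :=
  fun _ hf => (mem_branchesThrough_cons.1 hf).2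

theorem branchesThrough_subset_iUnion_cons (u : List α) :
    branchesThrough u ⊆ ⋃ a, branchesThrough (a :: u) :=
  fun f hf => Set.mem_iUnion.2 ⟨f u.length, mem_branchesThrough_cons.2 ⟨rfl, hf⟩⟩

theorem branchesThrough_anti {u v : List α} (h : u <:+ v) :
    branchesThrough v ⊆ branchesThrough u := by
  obtain ⟨l, rfl⟩ := h
  induction l with
  | nil => exact subset_rfl
  | cons a l ih => exact (branchesThrough_cons_subset a (l ++ u)).trans ih

theorem eq_of_mem_branchesThrough {f g : ℕ → α} {u : List α} (hf : f ∈ branchesThrough u)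
    (hg : g ∈ branchesThrough u) {i : ℕ} (hi : i < u.length) : f i = g i :=
  res_eq_res.1 (hf.trans hg.symm) hi

theorem nonempty_branchesThrough [Nonempty α] (u : List α) : (branchesThrough u).Nonempty := by
  induction u with
  | nil => simp [branchesThrough_nil]
  | cons a u ih =>
    obtain ⟨f, hf⟩ := ih
    refine ⟨Function.update f u.length a, mem_branchesThrough_cons.2 ⟨by simp, ?_⟩⟩
    exact (res_eq_res.2 fun i hi => Function.update_of_ne hi.ne _ _).trans hf

theorem res_suffix_res (f : ℕ → α) {m n : ℕ} (h : m ≤ n) : res f m <:+ res f n :=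
  Nat.le_induction (List.suffix_refl _) (fun _ _ ih => ih.trans (List.suffix_cons _ _)) n h

theorem exists_branch_of_chain [Nonempty α] {L : ℕ → List α} (hL : ∀ i, L i <:+ L (i + 1))
    (hlen : Tendsto (fun i => (L i).length) atTop atTop) :
    ∃ f : ℕ → α, ∀ i, f ∈ branchesThrough (L i) := by
  have hmono : ∀ i j, i ≤ j → L i <:+ L j := fun i =>
    Nat.le_induction (List.suffix_refl _) fun j _ ih => ih.trans (hL j)
  choose ι hι using fun m => (hlen.eventually_gt_atTop m).exists
  choose g hg using fun i => nonempty_branchesThrough (L i)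
  have hgg : ∀ i j, i ≤ j → ∀ m < (L i).length, g i m = g j m := fun i j h m hm =>
    eq_of_mem_branchesThrough (hg i) (branchesThrough_anti (hmono i j h) (hg j)) hm
  refine ⟨fun m => g (ι m) m, fun i => (res_eq_res.2 fun m hm => ?_).trans (hg i)⟩
  rcases le_total i (ι m) with h | h
  · exact (hgg i (ι m) h m hm).symm
  · exact hgg (ι m) i h m (hι m)

theorem tendsto_of_mem_branchesThrough [TopologicalSpace α] {L : ℕ → List α}
    (hlen : Tendsto (fun i => (L i).length) atTop atTop) {f : ℕ → α} {g : ℕ → ℕ → α}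
    (hf : ∀ i, f ∈ branchesThrough (L i)) (hg : ∀ i, g i ∈ branchesThrough (L i)) :
    Tendsto g atTop (𝓝 f) := by
  refine tendsto_pi_nhds.2 fun m => tendsto_const_nhds.congr' ?_
  filter_upwards [hlen.eventually_gt_atTop m] with i hi
  exact eq_of_mem_branchesThrough (hf i) (hg i) hi

end Positions

section Nonanticipating

variable {α β γ : Type*}

/-- `Φ` answers a sequence of moves in such a way that the `i`-th answer depends only on the moves
with index at most `i`: it is the map from plays of the opponent to outcomes that is induced by a
strategy. -/
def IsNonanticipating (Φ : (ℕ → α) → ℕ → β) : Prop :=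
  ∀ ⦃n n' : ℕ → α⦄ ⦃i : ℕ⦄, (∀ j ≤ i, n j = n' j) → Φ n i = Φ n' i

theorem IsNonanticipating.comp {Ψ : (ℕ → β) → ℕ → γ} {Φ : (ℕ → α) → ℕ → β}
    (hΨ : IsNonanticipating Ψ) (hΦ : IsNonanticipating Φ) : IsNonanticipating (Ψ ∘ Φ) :=
  fun _ _ _ h => hΨ fun _ hj => hΦ fun k hk => h k (hk.trans hj)

theorem IsNonanticipating.continuous [TopologicalSpace α] [DiscreteTopology α]
    [TopologicalSpace β] {Φ : (ℕ → α) → ℕ → β} (hΦ : IsNonanticipating Φ) : Continuous Φ := by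
  refine continuous_pi fun i => IsLocallyConstant.continuous ?_
  refine (IsLocallyConstant.iff_eventually_eq _).2 fun n => ?_
  filter_upwards [(isOpen_cylinder _ n (i + 1)).mem_nhds (self_mem_cylinder n _)] with n' hn'
  exact hΦ fun j hj => hn' j (Nat.lt_succ_of_le hj)

theorem isNonanticipating_outcome {X : Type*} (σ : List ℕ → X) :
    IsNonanticipating (outcome σ) := by
  intro n n' i h
  have : (List.range (i + 1)).map n = (List.range (i + 1)).map n' :=
    List.map_congr_left fun j hj => h j (Nat.le_of_lt_succ (List.mem_range.1 hj))
  rw [outcome, outcome, this]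

theorem IsNonanticipating.exists_outcome_eq {X : Type*} {Φ : (ℕ → ℕ) → ℕ → X}
    (hΦ : IsNonanticipating Φ) : ∃ σ : List ℕ → X, outcome σ = Φ := by
  refine ⟨fun l => Φ (fun j => l.getD j 0) (l.length - 1), funext₂ fun n i => ?_⟩
  rw [outcome, List.length_map, List.length_range, Nat.add_sub_cancel]
  exact hΦ fun j hj => by simp [Nat.lt_succ_of_le hj]

theorem iiHasStrategy_iff {𝕜 X : Type*} [RCLike 𝕜] [NormedAddCommGroup X] [NormedSpace 𝕜 X]
    {b : SchauderBasis 𝕜 X} {A : Set (ℕ → X)} :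
    IIHasStrategy b A ↔ ∃ Φ : (ℕ → ℕ) → ℕ → X, IsNonanticipating Φ ∧
      ∀ n, IsRun b n (Φ n) ∧ Φ n ∈ A := by
  constructor
  · rintro ⟨σ, hσ⟩
    exact ⟨outcome σ, isNonanticipating_outcome σ, hσ⟩
  · rintro ⟨Φ, hΦ, h⟩
    obtain ⟨σ, rfl⟩ := hΦ.exists_outcome_eq
    exact ⟨σ, h⟩

end Nonanticipating

section StronglyDominating

/-- `B` is strongly dominating from the position `t` on: a player whose bounds `φ` depend only on
the current position cannot force the plays through `t` that respect these bounds to avoid `B`. -/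
def StronglyDominatesFrom (t : List ℕ) (B : Set (ℕ → ℕ)) : Prop :=
  ∀ φ : List ℕ → ℕ, ∃ f ∈ B ∩ branchesThrough t, ∀ n ≥ t.length, φ (res f n) ≤ f n

theorem stronglyDominatesFrom_univ (t : List ℕ) : StronglyDominatesFrom t Set.univ := by
  intro φ
  let L : ℕ → List ℕ := fun i => (fun l => φ l :: l)^[i] t
  have hL : ∀ i, L (i + 1) = φ (L i) :: L i := fun i => Function.iterate_succ_apply' _ i t
  have hlen : ∀ i, (L i).length = t.length + i := fun i => by
    induction i with
    | zero => rfl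
    | succ i ih => rw [hL, List.length_cons, ih, add_assoc]
  obtain ⟨f, hf⟩ := exists_branch_of_chain (L := L) (fun i => hL i ▸ List.suffix_cons _ _)
    (by simpa only [hlen] using tendsto_atTop_mono (Nat.le_add_left · t.length) tendsto_id)
  refine ⟨f, ⟨Set.mem_univ f, hf 0⟩, fun n hn => ?_⟩
  obtain ⟨i, rfl⟩ := Nat.exists_eq_add_of_le hn
  have hfi : f (L i).length = φ (L i) := (mem_branchesThrough_cons.1 (hL i ▸ hf (i + 1))).1
  rw [← hlen, hf i, hfi]

theorem exists_witnessing_bound (t : List ℕ) (B : Set (ℕ → ℕ)) :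
    ∃ φ : List ℕ → ℕ, ∀ f ∈ B ∩ branchesThrough t,
      (∀ n ≥ t.length, φ (res f n) ≤ f n) → StronglyDominatesFrom t B := by
  by_contra! hcon
  obtain ⟨f, -, -, hf⟩ := hcon 0
  exact hf fun φ => (hcon φ).imp fun _ hg => ⟨hg.1, hg.2.1⟩

/-- The bounds for all pairs `(t, B k)` are amalgamated into one: at a position `r` only those with
`k ≤ r.length` and `t` an initial segment of `r` matter, which are finitely many. -/
theorem exists_common_witnessing_bound (B : ℕ → Set (ℕ → ℕ)) :
    ∃ ψ : List ℕ → ℕ, ∀ (k : ℕ) (t : List ℕ), k ≤ t.length → ∀ f ∈ B k ∩ branchesThrough t,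
      (∀ n ≥ t.length, ψ (res f n) ≤ f n) → StronglyDominatesFrom t (B k) := by
  choose φ hφ using fun (p : List ℕ × ℕ) => exists_witnessing_bound p.1 (B p.2)
  refine ⟨fun r => (r.tails.toFinset ×ˢ Finset.range (r.length + 1)).sup fun p => φ p r,
    fun k t hkt f hf hψ => hφ (t, k) f hf fun n hn => le_trans ?_ (hψ n hn)⟩
  have htn : t <:+ res f n := hf.2 ▸ res_suffix_res f hn
  refine Finset.le_sup (f := fun p => φ p (res f n)) ?_
  rw [Finset.mem_product, List.mem_toFinset, List.mem_tails, Finset.mem_range, res_length]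
  exact ⟨htn, Nat.lt_succ_of_le (hkt.trans hn)⟩

theorem StronglyDominatesFrom.exists_cons {t : List ℕ} {B : Set (ℕ → ℕ)}
    (h : StronglyDominatesFrom t B) (N : ℕ) : ∃ k ≥ N, StronglyDominatesFrom (k :: t) B := by
  obtain ⟨φ, hφ⟩ := exists_common_witnessing_bound fun _ => B
  obtain ⟨f, ⟨hfB, hft⟩, hf⟩ := h fun r => max N (φ r)
  refine ⟨f t.length, (le_max_left _ _).trans (hf _ le_rfl), hφ 0 _ (Nat.zero_le _) f
    ⟨hfB, mem_branchesThrough_cons.2 ⟨rfl, hft⟩⟩ fun n hn => ?_⟩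
  exact (le_max_right _ _).trans (hf n ((Nat.le_succ _).trans hn))

/-- A well-founded plan for reaching one of the sets of positions `W k` from a given position: stop
and record `k`, or answer the next bound `N` by the move `next N` and continue with the plan
`sub N`. -/
inductive ReachingPlan (W : ℕ → Set (List ℕ)) : List ℕ → Type
  | done {t : List ℕ} (k : ℕ) (mem : t ∈ W k) : ReachingPlan W t
  | move {t : List ℕ} (next : ℕ → ℕ) (le_next : ∀ N, N ≤ next N)
      (sub : ∀ N, ReachingPlan W (next N :: t)) : ReachingPlan W t

theorem ReachingPlan.exists_mem {W : ℕ → Set (List ℕ)} {t : List ℕ} (P : ReachingPlan W t) :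
    ∃ k, ∃ s ∈ W k, t <:+ s := by
  induction P with
  | @done t k mem => exact ⟨k, t, mem, List.suffix_refl t⟩
  | move next _ _ ih =>
    obtain ⟨k, s, hs, hts⟩ := ih 0
    exact ⟨k, s, hs, (List.suffix_cons _ _).trans hts⟩

theorem ReachingPlan.exists_bound_nonempty (W : ℕ → Set (List ℕ)) (t : List ℕ) :
    ∃ N, ∀ k ≥ N, Nonempty (ReachingPlan W (k :: t)) → Nonempty (ReachingPlan W t) := by
  by_contra! hcon
  choose next hnext hsub hempty using hcon
  exact (hempty 0).elim (.move next hnext fun N => (hsub N).some)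

theorem StronglyDominatesFrom.nonempty_reachingPlan {t : List ℕ} {B : Set (ℕ → ℕ)}
    (h : StronglyDominatesFrom t B) {D : ℕ → Set (ℕ → ℕ)} (hBD : B ⊆ ⋃ k, D k) :
    Nonempty (ReachingPlan (fun k => {s | StronglyDominatesFrom s (D k)}) t) := by
  set W : ℕ → Set (List ℕ) := fun k => {s | StronglyDominatesFrom s (D k)}
  choose χ hχ using ReachingPlan.exists_bound_nonempty W
  obtain ⟨ψ, hψ⟩ := exists_common_witnessing_bound D
  obtain ⟨f, ⟨hfB, hft⟩, hf⟩ := h fun r => max (χ r) (ψ r)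
  have hback : ∀ n ≥ t.length,
      Nonempty (ReachingPlan W (res f n)) → Nonempty (ReachingPlan W t) := by
    intro n hn
    induction n, hn using Nat.le_induction with
    | base => exact fun hP => hft ▸ hP
    | succ n hn ih => exact fun hP => ih (hχ _ _ ((le_max_left _ _).trans (hf n hn)) hP)
  obtain ⟨k, hk⟩ := Set.mem_iUnion.1 (hBD hfB)
  set m := max k t.length
  have hmem : res f m ∈ W k := by
    refine hψ k (res f m) (by simp [m]) f ⟨hk, mem_branchesThrough_res f m⟩ fun n hn => ?_
    rw [res_length] at hn
    exact (le_max_right _ _).trans (hf n ((le_max_right _ _).trans hn))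
  exact hback m (le_max_right _ _) ⟨.done k hmem⟩

end StronglyDominating

section Laver

variable {F : (ℕ → ℕ) → ℕ → ℕ}

/-- A state of the strategy that builds a branch `f` together with a witness `w` for `F w = f`: the
position `pos` reached by `f`, the initial segment `wit` of `w` fixed so far, and a plan for
reaching a position from which `wit` can be extended by one digit. -/
structure LaverState (F : (ℕ → ℕ) → ℕ → ℕ) where
  pos : List ℕ
  wit : List ℕ
  plan : ReachingPlan
    (fun k => {s | StronglyDominatesFrom s (F '' branchesThrough (k :: wit))}) pos

theorem StronglyDominatesFrom.exists_laverState {t u : List ℕ}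
    (h : StronglyDominatesFrom t (F '' branchesThrough u)) :
    ∃ s : LaverState F, s.pos = t ∧ s.wit = u := by
  have hcover : F '' branchesThrough u ⊆ ⋃ k, F '' branchesThrough (k :: u) := by
    rw [← Set.image_iUnion]
    exact Set.image_mono (branchesThrough_subset_iUnion_cons u)
  obtain ⟨P⟩ := h.nonempty_reachingPlan hcover
  exact ⟨⟨t, u, P⟩, rfl, rfl⟩

namespace LaverState

theorem exists_mem_image_branchesThrough (s : LaverState F) :
    ∃ w ∈ branchesThrough s.wit, F w ∈ branchesThrough s.pos := by
  obtain ⟨k, r, hr, hsr⟩ := s.plan.exists_mem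
  obtain ⟨_, ⟨⟨w, hw, rfl⟩, hwr⟩, -⟩ := hr 0
  exact ⟨w, branchesThrough_cons_subset k _ hw, branchesThrough_anti hsr hwr⟩

theorem exists_step_done {t u : List ℕ} {k : ℕ}
    (h : StronglyDominatesFrom t (F '' branchesThrough (k :: u))) (N : ℕ) :
    ∃ s : LaverState F, s.wit = k :: u ∧ ∃ m ≥ N, s.pos = m :: t := by
  obtain ⟨m, hm, hmt⟩ := h.exists_cons N
  obtain ⟨s, hpos, hwit⟩ := hmt.exists_laverState
  exact ⟨s, hwit, m, hm, hpos⟩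

/-- The state after the next bound `N`: the plan is followed, and once it is completed the digit
it records is added to the witness. -/
noncomputable def step : LaverState F → ℕ → LaverState F
  | ⟨_, _, .done _ h⟩, N => (exists_step_done h N).choose
  | ⟨t, u, .move next _ sub⟩, N => ⟨next N :: t, u, sub N⟩

theorem exists_pos_step (s : LaverState F) (N : ℕ) : ∃ k ≥ N, (s.step N).pos = k :: s.pos := by
  obtain ⟨t, u, ⟨k, h⟩ | ⟨next, le_next, sub⟩⟩ := s
  · exact (exists_step_done h N).choose_spec.2
  · exact ⟨next N, le_next N, rfl⟩

theorem wit_step_done {t u : List ℕ} {k : ℕ}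
    (h : StronglyDominatesFrom t (F '' branchesThrough (k :: u))) (N : ℕ) :
    (step ⟨t, u, .done k h⟩ N).wit = k :: u :=
  (exists_step_done h N).choose_spec.1

theorem wit_suffix_wit_step (s : LaverState F) (N : ℕ) : s.wit <:+ (s.step N).wit := by
  obtain ⟨t, u, ⟨k, h⟩ | ⟨next, le_next, sub⟩⟩ := s
  · exact wit_step_done h N ▸ List.suffix_cons k u
  · exact List.suffix_refl u

/-- The states run through when the opponent plays the bounds `N`. -/
noncomputable def run (s : LaverState F) (N : ℕ → ℕ) : ℕ → LaverState F
  | 0 => s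
  | i + 1 => (s.run N i).step (N i)

theorem run_congr (s : LaverState F) {N N' : ℕ → ℕ} {i : ℕ} (h : ∀ j < i, N j = N' j) :
    s.run N i = s.run N' i := by
  induction i with
  | zero => rfl
  | succ i ih =>
    rw [run, run, ih fun j hj => h j (hj.trans (Nat.lt_succ_self i)), h i (Nat.lt_succ_self i)]

theorem length_pos_run (s : LaverState F) (N : ℕ → ℕ) (i : ℕ) :
    (s.run N i).pos.length = s.pos.length + i := by
  induction i with
  | zero => rfl
  | succ i ih =>
    obtain ⟨k, -, hk⟩ := (s.run N i).exists_pos_step (N i)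
    rw [run, hk, List.length_cons, ih, add_assoc]

theorem tendsto_length_pos_run (s : LaverState F) (N : ℕ → ℕ) :
    Tendsto (fun i => (s.run N i).pos.length) atTop atTop := by
  simpa only [length_pos_run] using tendsto_atTop_mono (Nat.le_add_left · s.pos.length) tendsto_id

theorem exists_length_wit_lt (s : LaverState F) (N : ℕ → ℕ) (i : ℕ) :
    ∃ j, (s.run N i).wit.length < (s.run N j).wit.length := by
  rcases hi : s.run N i with ⟨t, u, P⟩
  induction P generalizing i with
  | done k h =>
    refine ⟨i + 1, ?_⟩
    rw [run, hi, wit_step_done h]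
    exact Nat.lt_succ_self _
  | move next le_next sub ih => exact ih (N i) (i + 1) (by rw [run, hi]; rfl)

theorem tendsto_length_wit_run (s : LaverState F) (N : ℕ → ℕ) :
    Tendsto (fun i => (s.run N i).wit.length) atTop atTop := by
  refine tendsto_atTop_atTop_of_monotone
    (monotone_nat_of_le_succ fun i => (wit_suffix_wit_step _ _).length_le) fun m => ?_
  induction m with
  | zero => exact ⟨0, Nat.zero_le _⟩
  | succ m ih =>
    obtain ⟨i, hi⟩ := ih
    obtain ⟨j, hj⟩ := s.exists_length_wit_lt N i
    exact ⟨j, hi.trans_lt hj⟩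

theorem exists_apply_mem_branchesThrough_pos_run (hF : Continuous F) (s : LaverState F)
    (N : ℕ → ℕ) : ∃ w ∈ branchesThrough s.wit, ∀ i, F w ∈ branchesThrough (s.run N i).pos := by
  obtain ⟨f, hf⟩ := exists_branch_of_chain (L := fun i => (s.run N i).pos)
    (fun i => by
      obtain ⟨k, -, hk⟩ := (s.run N i).exists_pos_step (N i)
      exact hk ▸ List.suffix_cons k _) (s.tendsto_length_pos_run N)
  obtain ⟨w, hw⟩ := exists_branch_of_chain (L := fun i => (s.run N i).wit)
    (fun i => (s.run N i).wit_suffix_wit_step (N i)) (s.tendsto_length_wit_run N)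
  choose v hvwit hvpos using fun i => (s.run N i).exists_mem_image_branchesThrough
  have hv : Tendsto v atTop (𝓝 w) :=
    tendsto_of_mem_branchesThrough (s.tendsto_length_wit_run N) hw hvwit
  have hFv : Tendsto (F ∘ v) atTop (𝓝 f) :=
    tendsto_of_mem_branchesThrough (s.tendsto_length_pos_run N) hf hvpos
  have hFw : F w = f := tendsto_nhds_unique ((hF.tendsto w).comp hv) hFv
  exact ⟨w, hw 0, fun i => hFw ▸ hf i⟩

end LaverState

/-- The sequences `Φ N` are the branches of a Laver tree with stem `t`, parametrised by the bounds
they exceed. -/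
theorem StronglyDominatesFrom.exists_isNonanticipating {t : List ℕ} {B : Set (ℕ → ℕ)}
    (h : StronglyDominatesFrom t B) (hB : AnalyticSet B) :
    ∃ Φ : (ℕ → ℕ) → ℕ → ℕ, IsNonanticipating Φ ∧
      ∀ N, Φ N ∈ B ∩ branchesThrough t ∧ ∀ i ≥ t.length, N i ≤ Φ N i := by
  rw [AnalyticSet] at hB
  obtain rfl | ⟨F, hF, rfl⟩ := hB
  · obtain ⟨f, ⟨hf, -⟩, -⟩ := h 0
    exact hf.elim
  rw [← Set.image_univ, ← branchesThrough_nil] at h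
  obtain ⟨s, rfl, -⟩ := h.exists_laverState
  let shift : (ℕ → ℕ) → ℕ → ℕ := fun N i => N (s.pos.length + i)
  choose w _ hw using fun N => s.exists_apply_mem_branchesThrough_pos_run hF (shift N)
  refine ⟨F ∘ w, fun N N' i hNN' => ?_, fun N => ⟨⟨⟨w N, rfl⟩, hw N 0⟩, fun i hi => ?_⟩⟩
  · have hrun : s.run (shift N) (i + 1 - s.pos.length) = s.run (shift N') (i + 1 - s.pos.length) :=
      s.run_congr fun j hj => hNN' _ (by omega)
    refine eq_of_mem_branchesThrough (hw N _) (hrun ▸ hw N' _) ?_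
    rw [s.length_pos_run]
    omega
  · obtain ⟨j, rfl⟩ := Nat.exists_eq_add_of_le hi
    obtain ⟨k, hk, hpos⟩ := (s.run (shift N) j).exists_pos_step (shift N j)
    have hbranch : F (w N) ∈ branchesThrough (k :: (s.run (shift N) j).pos) := hpos ▸ hw N (j + 1)
    rw [mem_branchesThrough_cons, s.length_pos_run] at hbranch
    exact hk.trans hbranch.1.ge

theorem exists_isNonanticipating_of_iUnion_eq_univ {B : ℕ → Set (ℕ → ℕ)}
    (hB : ∀ k, AnalyticSet (B k)) (hcover : ⋃ k, B k = Set.univ) :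
    ∃ (k m : ℕ) (Φ : (ℕ → ℕ) → ℕ → ℕ), IsNonanticipating Φ ∧
      ∀ N, Φ N ∈ B k ∧ ∀ i ≥ m, N i ≤ Φ N i := by
  obtain ⟨P⟩ := (stronglyDominatesFrom_univ []).nonempty_reachingPlan hcover.ge
  obtain ⟨k, t, ht, -⟩ := P.exists_mem
  obtain ⟨Φ, hΦ, hΦB⟩ := ht.exists_isNonanticipating (hB k)
  exact ⟨k, t.length, Φ, hΦ, fun N => ⟨(hΦB N).1.1, (hΦB N).2⟩⟩

end Laver

section Domination

variable {𝕜 ι E F G : Type*} [RCLike 𝕜] [NormedAddCommGroup E] [NormedSpace 𝕜 E]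
  [NormedAddCommGroup F] [NormedSpace 𝕜 F] [NormedAddCommGroup G] [NormedSpace 𝕜 G]

variable (𝕜) in
/-- The family `x` is `M`-dominated by the family `y`: finite linear combinations of `x` are at
most `M` times as long as those of `y` with the same coefficients. -/
def IsDominatedBy (M : ℝ) (x : ι → E) (y : ι → F) : Prop :=
  ∀ a : ι →₀ 𝕜, ‖Finsupp.linearCombination 𝕜 x a‖ ≤ M * ‖Finsupp.linearCombination 𝕜 y a‖

theorem IsDominatedBy.mono {M N : ℝ} {x : ι → E} {y : ι → F} (h : IsDominatedBy 𝕜 M x y)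
    (hMN : M ≤ N) : IsDominatedBy 𝕜 N x y :=
  fun a => (h a).trans (by gcongr)

theorem IsDominatedBy.trans {M N : ℝ} (hM : 0 ≤ M) {x : ι → E} {y : ι → F} {z : ι → G}
    (hxy : IsDominatedBy 𝕜 M x y) (hyz : IsDominatedBy 𝕜 N y z) :
    IsDominatedBy 𝕜 (M * N) x z := fun a => calc
  ‖Finsupp.linearCombination 𝕜 x a‖ ≤ M * ‖Finsupp.linearCombination 𝕜 y a‖ := hxy a
  _ ≤ M * (N * ‖Finsupp.linearCombination 𝕜 z a‖) := by gcongr; exact hyz a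
  _ = M * N * ‖Finsupp.linearCombination 𝕜 z a‖ := (mul_assoc _ _ _).symm

theorem isClosed_isDominatedBy (M : ℝ) :
    IsClosed {p : (ι → E) × (ι → F) | IsDominatedBy 𝕜 M p.1 p.2} := by
  simp only [IsDominatedBy, Set.ofPred_forall, Finsupp.linearCombination_apply, Finsupp.sum]
  exact isClosed_iInter fun a => isClosed_le (by fun_prop) (by fun_prop)

theorem isDominatedBy_comp (T : E →L[𝕜] F) (x : ι → E) : IsDominatedBy 𝕜 ‖T‖ (T ∘ x) x := by
  intro a
  calc ‖Finsupp.linearCombination 𝕜 (T ∘ x) a‖ = ‖T (Finsupp.linearCombination 𝕜 x a)‖ :=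
        congrArg norm ((T : E →ₗ[𝕜] F).map_finsupp_linearCombination a).symm
    _ ≤ ‖T‖ * ‖Finsupp.linearCombination 𝕜 x a‖ := T.le_opNorm _

theorem isDominatedBy_of_norm_coeff_le {c : ℝ} {x y : ι → E}
    (hc : ∀ (a : ι →₀ 𝕜) (i : ι), ‖a i‖ ≤ c * ‖Finsupp.linearCombination 𝕜 x a‖)
    {s : Finset ι} (hs : ∀ i ∉ s, y i = x i) :
    IsDominatedBy 𝕜 (1 + c * ∑ i ∈ s, ‖y i - x i‖) y x := by
  classical
  intro a
  have hsum : ∀ z : ι → E, Finsupp.linearCombination 𝕜 z a = ∑ i ∈ a.support ∪ s, a i • z i :=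
    fun z => Finsupp.sum_of_support_subset a Finset.subset_union_left _ (by simp)
  have hdiff : Finsupp.linearCombination 𝕜 y a - Finsupp.linearCombination 𝕜 x a =
      ∑ i ∈ s, a i • (y i - x i) := by
    simp only [hsum, ← Finset.sum_sub_distrib, ← smul_sub]
    refine (Finset.sum_subset Finset.subset_union_right fun i _ hi => ?_).symm
    rw [hs i hi, sub_self, smul_zero]
  set v := Finsupp.linearCombination 𝕜 x a
  calc ‖Finsupp.linearCombination 𝕜 y a‖ ≤ ‖v‖ + ‖Finsupp.linearCombination 𝕜 y a - v‖ :=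
        norm_le_norm_add_norm_sub' _ _
    _ ≤ ‖v‖ + ∑ i ∈ s, c * ‖v‖ * ‖y i - x i‖ := by
        rw [hdiff]
        gcongr
        refine norm_sum_le_of_le s fun i _ => ?_
        rw [norm_smul]
        exact mul_le_mul_of_nonneg_right (hc a i) (norm_nonneg _)
    _ = (1 + c * ∑ i ∈ s, ‖y i - x i‖) * ‖v‖ := by rw [← Finset.mul_sum]; ring

theorem IsDominatedBy.exists_continuousLinearEquiv [CompleteSpace E] [CompleteSpace F] {M N : ℝ}
    (hM : 0 ≤ M) (hN : 0 ≤ N) {x : ι → E} {y : ι → F}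
    (hxy : IsDominatedBy 𝕜 M x y) (hyx : IsDominatedBy 𝕜 N y x)
    (hx : DenseRange (Finsupp.linearCombination 𝕜 x))
    (hy : DenseRange (Finsupp.linearCombination 𝕜 y)) :
    ∃ T : E ≃L[𝕜] F, (∀ i, T (x i) = y i) ∧
      ‖(T : E →L[𝕜] F)‖ ≤ N ∧ ‖(T.symm : F →L[𝕜] E)‖ ≤ M := by
  refine ⟨(LinearEquiv.refl 𝕜 (ι →₀ 𝕜)).extend (Finsupp.linearCombination 𝕜 x)
    (Finsupp.linearCombination 𝕜 y) hx ⟨N, hyx⟩ hy ⟨M, hxy⟩, fun i => ?_, ?_, ?_⟩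
  · rw [← one_smul 𝕜 (x i), ← Finsupp.linearCombination_single, LinearEquiv.extend_eq,
      LinearEquiv.refl_apply, Finsupp.linearCombination_single, one_smul]
  · exact ContinuousLinearMap.opNorm_le_bound _ hN
      (LinearEquiv.norm_extend_le (LinearEquiv.refl 𝕜 (ι →₀ 𝕜)) _ _ N hx hyx hy ⟨M, hxy⟩)
  · exact ContinuousLinearMap.opNorm_le_bound _ hM
      (LinearEquiv.norm_extend_symm_le (LinearEquiv.refl 𝕜 (ι →₀ 𝕜)) _ _ M hx ⟨N, hyx⟩ hy hxy)

end Domination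

section Equivalence

variable {𝕜 X : Type*} [RCLike 𝕜] [NormedAddCommGroup X] [NormedSpace 𝕜 X] {x y : ℕ → X}

variable (𝕜) in
/-- The sequence `x`, as a sequence in its closed linear span. -/
def toClosedSpan (x : ℕ → X) (i : ℕ) : closedSpan 𝕜 x :=
  ⟨x i, mem_closedSpan 𝕜 x i⟩

theorem coe_linearCombination_toClosedSpan (x : ℕ → X) (a : ℕ →₀ 𝕜) :
    (Finsupp.linearCombination 𝕜 (toClosedSpan 𝕜 x) a : X) = Finsupp.linearCombination 𝕜 x a :=
  (closedSpan 𝕜 x).subtype.map_finsupp_linearCombination a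

theorem isDominatedBy_toClosedSpan_iff {M : ℝ} :
    IsDominatedBy 𝕜 M (toClosedSpan 𝕜 x) (toClosedSpan 𝕜 y) ↔ IsDominatedBy 𝕜 M x y := by
  refine forall_congr' fun a => ?_
  rw [← coe_linearCombination_toClosedSpan x, ← coe_linearCombination_toClosedSpan y,
    Submodule.coe_norm, Submodule.coe_norm]

theorem denseRange_linearCombination_toClosedSpan (x : ℕ → X) :
    DenseRange (Finsupp.linearCombination 𝕜 (toClosedSpan 𝕜 x)) := by
  rw [DenseRange, Subtype.dense_iff]
  refine fun v hv => closure_mono (fun w hw => ?_) hv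
  obtain ⟨a, rfl⟩ := Finsupp.mem_span_range_iff_exists_finsupp.1 hw
  exact ⟨_, ⟨a, rfl⟩, coe_linearCombination_toClosedSpan x a⟩

theorem SeqEquiv.exists_isDominatedBy (h : SeqEquiv 𝕜 x y) :
    ∃ K : ℕ, IsDominatedBy 𝕜 K x y ∧ IsDominatedBy 𝕜 K y x := by
  obtain ⟨T, hT⟩ := h
  have hTx : T ∘ toClosedSpan 𝕜 x = toClosedSpan 𝕜 y := funext hT
  have hTy : T.symm ∘ toClosedSpan 𝕜 y = toClosedSpan 𝕜 x := by
    rw [← hTx, ← Function.comp_assoc, T.symm_comp_self, Function.id_comp]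
  have hyx := isDominatedBy_comp T.toContinuousLinearMap (toClosedSpan 𝕜 x)
  have hxy := isDominatedBy_comp T.symm.toContinuousLinearMap (toClosedSpan 𝕜 y)
  rw [ContinuousLinearEquiv.coe_coe, hTx, isDominatedBy_toClosedSpan_iff] at hyx
  rw [ContinuousLinearEquiv.coe_coe, hTy, isDominatedBy_toClosedSpan_iff] at hxy
  obtain ⟨K, hK⟩ := exists_nat_ge
    (max ‖T.symm.toContinuousLinearMap‖ ‖T.toContinuousLinearMap‖)
  exact ⟨K, hxy.mono ((le_max_left _ _).trans hK), hyx.mono ((le_max_right _ _).trans hK)⟩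

theorem IsDominatedBy.seqEquivConst [CompleteSpace X] {M N : ℝ} (hM : 0 ≤ M) (hN : 0 ≤ N)
    (hxy : IsDominatedBy 𝕜 M x y) (hyx : IsDominatedBy 𝕜 N y x) :
    SeqEquivConst 𝕜 (M * N) x y := by
  have hcomplete : ∀ z : ℕ → X, CompleteSpace (closedSpan 𝕜 z) := fun z =>
    (Submodule.isClosed_topologicalClosure _).completeSpace_coe
  rw [← isDominatedBy_toClosedSpan_iff] at hxy hyx
  obtain ⟨T, hT, hTN, hTM⟩ := hxy.exists_continuousLinearEquiv hM hN hyx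
    (denseRange_linearCombination_toClosedSpan x) (denseRange_linearCombination_toClosedSpan y)
  exact ⟨T, hT, (mul_le_mul hTN hTM (norm_nonneg _) hN).trans_eq (mul_comm N M)⟩

end Equivalence

section BlockSequences

variable {𝕜 X : Type*} [RCLike 𝕜] [NormedAddCommGroup X] [NormedSpace 𝕜 X]
  {b : SchauderBasis 𝕜 X}

theorem proj_eq_zero {v : X} {p : ℕ} (h : ∀ i ∈ supp b v, p ≤ i) : b.proj p v = 0 := by
  rw [SchauderBasis.proj_apply]
  refine Finset.sum_eq_zero fun i hi => ?_
  have hv : b.coord i v = 0 := by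
    by_contra hv
    exact (Finset.mem_range.1 hi).not_ge (h i hv)
  rw [hv, zero_smul]

theorem proj_eq_self {v : X} {p : ℕ} (h : ∀ i ∈ supp b v, i < p) : b.proj p v = v := by
  refine tendsto_nhds_unique (tendsto_const_nhds.congr' ?_) (b.tendsto_proj v)
  filter_upwards [eventually_ge_atTop p] with n hn
  rw [SchauderBasis.proj_apply, SchauderBasis.proj_apply]
  refine Finset.sum_subset (Finset.range_subset_range.2 hn) fun i _ hi => ?_
  have hv : b.coord i v = 0 := by
    by_contra hv
    exact hi (Finset.mem_range.2 (h i hv))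
  rw [hv, zero_smul]

theorem supp_nonempty {v : X} (hv : v ≠ 0) : (supp b v).Nonempty := by
  contrapose! hv
  rw [← proj_eq_self (b := b) (v := v) (p := 0) (by simp [hv]), SchauderBasis.proj_apply,
    Finset.range_zero, Finset.sum_empty]

theorem supp_nonempty_of_mem_bb {x : ℕ → X} (hx : x ∈ bb b) (i : ℕ) : (supp b (x i)).Nonempty :=
  supp_nonempty (norm_ne_zero_iff.1 (hx.2.1 i ▸ one_ne_zero))

theorem vecBelow_of_lt {x : ℕ → X} (hx : x ∈ bb b) {i j : ℕ} (hij : i < j) :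
    VecBelow b (x i) (x j) := by
  induction j, hij using Nat.le_induction with
  | base => exact hx.2.2 i
  | succ j _ ih =>
    intro k hk l hl
    obtain ⟨q, hq⟩ := supp_nonempty_of_mem_bb hx j
    exact (ih k hk q hq).trans (hx.2.2 j q hq l hl)

theorem exists_proj_linearCombination {x : ℕ → X} (hx : x ∈ bb b) (m : ℕ) :
    ∃ p, ∀ a : ℕ →₀ 𝕜, b.proj p (Finsupp.linearCombination 𝕜 x a) =
      ∑ i ∈ Finset.range m, a i • x i := by
  have hmin : sInf (supp b (x m)) ∈ supp b (x m) := Nat.sInf_mem (supp_nonempty_of_mem_bb hx m)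
  set p := sInf (supp b (x m))
  have hlt : ∀ i < m, b.proj p (x i) = x i := fun i hi =>
    proj_eq_self fun j hj => vecBelow_of_lt hx hi j hj p hmin
  have hge : ∀ i, m ≤ i → b.proj p (x i) = 0 := by
    refine fun i hi => proj_eq_zero fun j hj => ?_
    rcases hi.eq_or_lt with rfl | hi
    · exact Nat.sInf_le hj
    · exact (vecBelow_of_lt hx hi p hmin j hj).le
  refine ⟨p, fun a => ?_⟩
  induction a using Finsupp.induction_linear with
  | zero => simp
  | add a a' h h' => simp only [map_add, h, h', Finsupp.add_apply, add_smul, Finset.sum_add_distrib]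
  | single j c =>
    rw [Finsupp.linearCombination_single, map_smul]
    rcases lt_or_ge j m with hj | hj
    · simp [Finsupp.single_apply, ite_smul, hlt j hj, hj]
    · simp [Finsupp.single_apply, ite_smul, hge j hj, hj]

theorem norm_coeff_le {B : ℝ} (hB : ∀ n, ‖b.proj n‖ ≤ B) {x : ℕ → X} (hx : x ∈ bb b)
    (a : ℕ →₀ 𝕜) (i : ℕ) : ‖a i‖ ≤ 2 * B * ‖Finsupp.linearCombination 𝕜 x a‖ := by
  obtain ⟨p, hp⟩ := exists_proj_linearCombination hx i
  obtain ⟨q, hq⟩ := exists_proj_linearCombination hx (i + 1)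
  have hterm : a i • x i = b.proj q (Finsupp.linearCombination 𝕜 x a) -
      b.proj p (Finsupp.linearCombination 𝕜 x a) := by
    rw [hp, hq, Finset.sum_range_succ, add_sub_cancel_left]
  calc ‖a i‖ = ‖a i • x i‖ := by rw [norm_smul, hx.2.1 i, mul_one]
    _ ≤ ‖b.proj q (Finsupp.linearCombination 𝕜 x a)‖ +
        ‖b.proj p (Finsupp.linearCombination 𝕜 x a)‖ := hterm ▸ norm_sub_le _ _
    _ ≤ B * ‖Finsupp.linearCombination 𝕜 x a‖ + B * ‖Finsupp.linearCombination 𝕜 x a‖ :=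
        add_le_add ((b.proj q).le_of_opNorm_le (hB q) _) ((b.proj p).le_of_opNorm_le (hB p) _)
    _ = 2 * B * ‖Finsupp.linearCombination 𝕜 x a‖ := by ring

theorem isDominatedBy_of_eventually_eq {B : ℝ} (hB : ∀ n, ‖b.proj n‖ ≤ B) {x y : ℕ → X}
    (hx : x ∈ bb b) (hy : y ∈ bb b) {m : ℕ} (h : ∀ i ≥ m, y i = x i) :
    IsDominatedBy 𝕜 (1 + 4 * B * m) y x := by
  have hB0 : 0 ≤ B := (norm_nonneg _).trans (hB 0)
  refine (isDominatedBy_of_norm_coeff_le (norm_coeff_le hB hx) (s := Finset.range m)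
    fun i hi => h i (by simpa using hi)).mono ?_
  have hsum : ∑ i ∈ Finset.range m, ‖y i - x i‖ ≤ m * 2 := by
    refine (Finset.sum_le_card_nsmul _ _ 2 fun i _ => ?_).trans (by simp)
    exact (norm_sub_le _ _).trans (by rw [hx.2.1, hy.2.1]; norm_num)
  calc 1 + 2 * B * ∑ i ∈ Finset.range m, ‖y i - x i‖ ≤ 1 + 2 * B * (m * 2) := by gcongr
    _ = 1 + 4 * B * m := by ring

/-- The basis vectors, scaled to norm one. -/
noncomputable def normalizedBasis (b : SchauderBasis 𝕜 X) (i : ℕ) : X :=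
  ((‖b i‖⁻¹ : ℝ) : 𝕜) • b i

theorem norm_normalizedBasis (i : ℕ) : ‖normalizedBasis b i‖ = 1 := by
  simpa [normalizedBasis] using norm_smul_inv_norm (𝕜 := 𝕜) (b.linearIndependent.ne_zero i)

theorem normalizedBasis_mem_span (i : ℕ) :
    normalizedBasis b i ∈ Submodule.span 𝕜 (Set.range b) :=
  Submodule.smul_mem _ _ (Submodule.subset_span ⟨i, rfl⟩)

theorem eq_of_mem_supp_normalizedBasis {i j : ℕ} (h : j ∈ supp b (normalizedBasis b i)) :
    j = i := by
  by_contra hne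
  exact h (by simp [normalizedBasis, b.ortho, hne])

theorem isRun_ite_normalizedBasis {x : ℕ → X} (hx : x ∈ bb b) {n N : ℕ → ℕ}
    (hN : StrictMono N) (hnN : ∀ i, n i < N i) {m : ℕ} (hNx : ∀ i ≥ m, NatBelow b (N i) (x i)) :
    IsRun b n fun i => if i < m then normalizedBasis b (N i) else x i := by
  refine ⟨⟨fun i => ?_, fun i => ?_, fun i => ?_⟩, fun i => ?_⟩ <;> dsimp only
  · split_ifs
    exacts [normalizedBasis_mem_span _, hx.1 i]
  · split_ifs
    exacts [norm_normalizedBasis _, hx.2.1 i]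
  · split_ifs with hi hi' hi'
    · intro k hk l hl
      rw [eq_of_mem_supp_normalizedBasis hk, eq_of_mem_supp_normalizedBasis hl]
      exact hN (Nat.lt_succ_self i)
    · intro k hk l hl
      rw [eq_of_mem_supp_normalizedBasis hk]
      exact (hN (Nat.lt_succ_self i)).trans (hNx _ (not_lt.1 hi') l hl)
    · exact absurd ((Nat.lt_succ_self i).trans hi') hi
    · exact hx.2.2 i
  · split_ifs with hi
    · exact fun k hk => eq_of_mem_supp_normalizedBasis hk ▸ hnN i
    · exact fun k hk => (hnN i).trans (hNx i (not_lt.1 hi) k hk)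

end BlockSequences

section Game

theorem analyticSet_setOf_exists_mem_prod {α β : Type*} [TopologicalSpace α] [PolishSpace α]
    [TopologicalSpace β] {A : Set β} (hA : AnalyticSet A) {C : Set (α × β)} (hC : IsClosed C) :
    AnalyticSet {a | ∃ y ∈ A, (a, y) ∈ C} := by
  obtain ⟨γ, _, _, F, hF, rfl⟩ := analyticSet_iff_exists_polishSpace_range.1 hA
  have hclosed : IsClosed {p : α × γ | (p.1, F p.2) ∈ C} := hC.preimage (by fun_prop)
  convert hclosed.analyticSet.image_of_continuous continuous_fst using 1
  ext a
  simp

variable {𝕜 X : Type*} [RCLike 𝕜] [NormedAddCommGroup X] [NormedSpace 𝕜 X] {A : Set (ℕ → X)}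

theorem exists_uniform_isDominatedBy (hA : AnalyticSet A) {Ψ : (ℕ → ℕ) → ℕ → X}
    (hΨ : Continuous Ψ) (hΨA : ∀ n, ∃ y ∈ A, SeqEquiv 𝕜 (Ψ n) y) :
    ∃ (K m : ℕ) (Φ : (ℕ → ℕ) → ℕ → ℕ), IsNonanticipating Φ ∧ ∀ N,
      (∃ y ∈ A, IsDominatedBy 𝕜 K (Ψ (Φ N)) y ∧ IsDominatedBy 𝕜 K y (Ψ (Φ N))) ∧
        ∀ i ≥ m, N i ≤ Φ N i := by
  refine exists_isNonanticipating_of_iUnion_eq_univ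
    (B := fun K : ℕ => {n | ∃ y ∈ A, IsDominatedBy 𝕜 K (Ψ n) y ∧ IsDominatedBy 𝕜 K y (Ψ n)})
    (fun K => ?_) (Set.eq_univ_of_forall fun n => ?_)
  · have hxy := (isClosed_isDominatedBy (𝕜 := 𝕜) (ι := ℕ) (E := X) (F := X) K).preimage
      (f := fun p : (ℕ → ℕ) × (ℕ → X) => (Ψ p.1, p.2)) (by fun_prop)
    have hyx := (isClosed_isDominatedBy (𝕜 := 𝕜) (ι := ℕ) (E := X) (F := X) K).preimage
      (f := fun p : (ℕ → ℕ) × (ℕ → X) => (p.2, Ψ p.1)) (by fun_prop)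
    exact analyticSet_setOf_exists_mem_prod hA (hxy.inter hyx)
  · obtain ⟨y, hy, hequiv⟩ := hΨA n
    obtain ⟨K, hK⟩ := hequiv.exists_isDominatedBy
    exact Set.mem_iUnion.2 ⟨K, y, hy, hK⟩

theorem seqEquivConst_of_eventually_eq [CompleteSpace X] {b : SchauderBasis 𝕜 X} {B : ℝ}
    (hB : ∀ n, ‖b.proj n‖ ≤ B) {x x' y : ℕ → X} (hx : x ∈ bb b) (hx' : x' ∈ bb b) {m : ℕ}
    (heq : ∀ i ≥ m, x' i = x i) {K : ℝ} (hK : 0 ≤ K) (hxy : IsDominatedBy 𝕜 K x y)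
    (hyx : IsDominatedBy 𝕜 K y x) :
    SeqEquivConst 𝕜 ((1 + 4 * B * m) * K * (K * (1 + 4 * B * m))) x' y := by
  have hB0 : 0 ≤ B := (norm_nonneg _).trans (hB 0)
  have hx'x := isDominatedBy_of_eventually_eq hB hx hx' heq
  have hxx' := isDominatedBy_of_eventually_eq hB hx' hx fun i hi => (heq i hi).symm
  exact (hx'x.trans (by positivity) hxy).seqEquivConst (by positivity) (by positivity)
    (hyx.trans hK hxx')

theorem exists_isNonanticipating_strictMono :
    ∃ Λ : (ℕ → ℕ) → ℕ → ℕ, IsNonanticipating Λ ∧ ∀ n, StrictMono (Λ n) ∧ ∀ i, n i < Λ n i := by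
  refine ⟨fun n i => ∑ j ∈ Finset.range (i + 1), (n j + 1), fun n n' i h => ?_, fun n =>
    ⟨strictMono_nat_of_lt_succ fun i => ?_, fun i => ?_⟩⟩ <;> dsimp only
  · exact Finset.sum_congr rfl fun j hj => by rw [h j (Nat.le_of_lt_succ (Finset.mem_range.1 hj))]
  · rw [Finset.sum_range_succ _ (i + 1)]
    exact Nat.lt_add_of_pos_right (Nat.succ_pos _)
  · rw [Finset.sum_range_succ]
    exact Nat.lt_of_lt_of_le (Nat.lt_succ_self _) (Nat.le_add_left _ _)

end Game

end AsymptoticGame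

open AsymptoticGame in
theorem mainTheorem11_general {𝕜 X : Type*} [RCLike 𝕜] [NormedAddCommGroup X] [NormedSpace 𝕜 X]
    [CompleteSpace X] (b : SchauderBasis 𝕜 X) (A : Set (ℕ → X)) (hA : AnalyticSet A)
    (hII : IIHasStrategy b (saturation b A)) :
    ∃ K : ℝ, 1 ≤ K ∧ IIHasStrategy b (saturationConst b K A) := by
  obtain ⟨Ψ, hΨ, hrun⟩ := iiHasStrategy_iff.1 hII
  obtain ⟨K, m, Φ, hΦ, hΦA⟩ := exists_uniform_isDominatedBy hA hΨ.continuous fun n => (hrun n).2.2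
  obtain ⟨Λ, hΛ, hΛn⟩ := exists_isNonanticipating_strictMono
  obtain ⟨B, hB⟩ := b.exists_norm_proj_le
  let x : (ℕ → ℕ) → ℕ → X := fun n => Ψ (Φ (Λ n))
  let x' : (ℕ → ℕ) → ℕ → X := fun n i => if i < m then normalizedBasis b (Λ n i) else x n i
  have hx : ∀ n, IsRun b (Φ (Λ n)) (x n) := fun n => (hrun _).1
  have hx' : ∀ n, IsRun b n (x' n) := fun n =>
    isRun_ite_normalizedBasis (hx n).1 (hΛn n).1 (hΛn n).2 fun i hi j hj =>
      ((hΦA (Λ n)).2 i hi).trans_lt ((hx n).2 i j hj)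
  have hx'_nonanticipating : IsNonanticipating x' := fun n n' i h => by
    have hxi : x n i = x n' i := hΨ.comp (hΦ.comp hΛ) h
    simp only [x', hΛ h, hxi]
  refine ⟨max 1 ((1 + 4 * B * m) * K * (K * (1 + 4 * B * m))), le_max_left _ _,
    iiHasStrategy_iff.2 ⟨x', hx'_nonanticipating, fun n => ⟨hx' n, (hx' n).1, ?_⟩⟩⟩
  obtain ⟨⟨y, hy, hxy, hyx⟩, -⟩ := hΦA (Λ n)
  obtain ⟨T, hT, hTK⟩ := seqEquivConst_of_eventually_eq hB (hx n).1 (hx' n).1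
    (fun i hi => if_neg hi.not_gt) K.cast_nonneg hxy hyx
  exact ⟨y, hy, T, hT, hTK.trans (le_max_right _ _)⟩

theorem mainTheorem11 {𝕜 X : Type*} [RCLike 𝕜] [NormedAddCommGroup X] [NormedSpace 𝕜 X]
    [CompleteSpace X] (b : SchauderBasis 𝕜 X) (A : Set (ℕ → X))
    (hA : A ⊆ AsymptoticGame.bb b) (hA' : AnalyticSet A)
    (hII : AsymptoticGame.IIHasStrategy b (AsymptoticGame.saturation b A)) :
    ∃ K : ℝ, 1 ≤ K ∧
      AsymptoticGame.IIHasStrategy b (AsymptoticGame.saturationConst b K A) :=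
  mainTheorem11_general b A hA' hII
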